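/- For $W\in\mathbb{R}^{d\times d}$ let $\mathcal{D}(W,0)$ denote the distribution on $\mathbb{R}^d$ of $\mathrm{ReLU}(Wz)$, where $z\sim\mathcal{N}(0,I_d)$ and $\mathrm{ReLU}(x)=\max(x,0)$ is applied coordinatewise, and let $S_d:=\{\mathcal{D}(W,0): W\in\mathbb{R}^{d\times d}\text{ full rank}\}$. Let $\mathrm{TV}(p,q)=\sup_B|p(B)-q(B)|$ (supremum over the measurable sets $B$) be the total variation distance. An algorithm with $n$ samples is a possibly randomized (measurable) procedure that takes $n$ points of $\mathbb{R}^d$ and outputs a probability distribution $q$ on $\mathbb{R}^d$, which need not belong to $S_d$; it learns $S_d$ within total variation distance $\epsilon$ and with success probability at least $2/3$ if for every $p\in S_d$, given $n$ i.i.d. samples from $p$, it outputs $q$ with $\mathrm{TV}(p,q)\le\epsilon$ with probability at least $2/3$. Any algorithm that learns $S_d$ within total variation distance $\epsilon$ and with success probability at least $2/3$ requires $\Omega(d/\epsilon^2)$ samples. That is, there are universal constants $c>0$ and $\epsilon_0>0$ such that for every dimension $d$ and every $\epsilon\in(0,\epsilon_0]$, every such algorithm uses $n\ge c\,d/\epsilon^2$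 samples. -/

import Mathlib

open MeasureTheory ProbabilityTheory

/-- The map `z ↦ ReLU(W z + b)` from `ℝᵏ` to `ℝᵈ`, the ReLU acting coordinatewise. -/
def reluLayer {d k : ℕ} (W : Matrix (Fin d) (Fin k) ℝ) (b : Fin d → ℝ) (z : Fin k → ℝ) :
    Fin d → ℝ :=
  fun i => max ((W.mulVec z + b) i) 0

theorem measurable_reluLayer {d k : ℕ} (W : Matrix (Fin d) (Fin k) ℝ) (b : Fin d → ℝ) :
    Measurable (reluLayer W b) := by
  have h : Continuous (reluLayer W b) := by
    refine continuous_pi fun i => ?_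
    have h1 : Continuous fun z : Fin k → ℝ => W.mulVec z :=
      Continuous.matrix_mulVec continuous_const continuous_id
    have h2 : Continuous fun z : Fin k → ℝ => (W.mulVec z + b) i :=
      (continuous_apply i).comp (h1.add continuous_const)
    exact h2.max continuous_const
  exact h.measurable

/-- The rectified Gaussian distribution `𝒟(W, b)` on `ℝᵈ`: the law of `ReLU(W z + b)`, where
the `k` coordinates of `z` are independent standard normal variables. -/
noncomputable def rectifiedGaussian {d k : ℕ} (W : Matrix (Fin d) (Fin k) ℝ) (b : Fin d → ℝ) :
    ProbabilityMeasure (Fin d → ℝ) :=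
  ⟨(Measure.pi fun _ : Fin k => gaussianReal 0 1).map (reluLayer W b),
    Measure.isProbabilityMeasure_map (measurable_reluLayer W b).aemeasurable⟩

/-- The class `{𝒟(W, 0) : W ∈ ℝ^{d × d} full rank}`. -/
def fullRankClass (d : ℕ) : Set (ProbabilityMeasure (Fin d → ℝ)) :=
  {p | ∃ W : Matrix (Fin d) (Fin d) ℝ, W.rank = d ∧ p = rectifiedGaussian W 0}

/-- Total variation distance between probability measures: the supremum of `|p(B) - q(B)|` over
the measurable sets `B`. -/
noncomputable def tvDist {E : Type*} [MeasurableSpace E] (p q : ProbabilityMeasure E) : ℝ :=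
  ⨆ B : {B : Set E // MeasurableSet B},
    |(p : Measure E).real (B : Set E) - (q : Measure E).real (B : Set E)|

/-- A (possibly randomized) distribution learning algorithm that uses `n` samples from `E` is a
Markov kernel: it maps the sample to the law of its output, and the output is an arbitrary
probability measure on `E`, which need not belong to the class that is to be learned.

The algorithm `A` learns the class `S` within total variation distance `ε` and with success
probability at least `2/3` if for every `p` in `S`, when its input consists of `n` i.i.d. samples
from `p`, its output `q` satisfies `TV(p, q) ≤ ε` with probability at least `2/3`. The probability
is over the sample and the internal randomness of the algorithm. -/
def LearnsInTV {E : Type*} [MeasurableSpace E] {n : ℕ}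
    (A : Kernel (Fin n → E) (ProbabilityMeasure E)) (S : Set (ProbabilityMeasure E)) (ε : ℝ) :
    Prop :=
  ∀ p ∈ S,
    (2 / 3 : ℝ) ≤
      ((Measure.pi fun _ : Fin n => (p : Measure E)).bind A).real {q | tvDist p q ≤ ε}

/-! Diagonal weights already force the bound. For a word `v : Fin d → Fin 16` take the diagonal
weights `(s v i)⁻¹` with `s v i = 1 + δ * v i`, where `δ` is of order `ε / √d`. Two facts pull
against each other.

The samples are hard to tell apart. Before rectification, the law for `v` has a density with respect
to the law for the zero word whose second moment is at most `exp (C d δ²)`. This tensorizes to `exp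
(C' n ε²)` for `n` samples (`HasSquareDensity.pi`, `hasSquareDensity_scaledGaussian`). Rectification
costs nothing, since it can be absorbed into the procedure.

The targets are far apart. If two words differ in a quarter of the coordinates, their rectified laws
are more than `2ε` apart (`exists_measureReal_sub_gt`). The witness is a signed count of the
coordinates above `1`: between the two laws its mean moves by order `d δ`, while its fluctuations
are of order `√d`. Truncating it at a multiple of `√d` turns this shift into a total variation gap
of order `√d δ`.

Hence the words whose laws are `ε`-close to one output pairwise differ in fewer than `d / 4`
coordinates, and there are at most `4 ^ d` of them (`card_filter_hamming_lt_le`). Averaging over all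
`16 ^ d` words and changing measure to the zero word (`card_le_of_forall_bind_ge`) gives `4/9 * 16 ^
d ≤ exp (C' n ε²) * 4 ^ d`, so `n ε²` is at least of order `d`. No code has to be selected: counting
nearby words replaces a packing. -/

open scoped ENNReal NNReal

/-! ### Densities with bounded second moment and change of measure -/

/-- `P` has a density with respect to `Q` whose second moment is at most `exp κ`. -/
def HasSquareDensity {E : Type*} [MeasurableSpace E] (P Q : Measure E) (κ : ℝ) : Prop :=
  ∃ L : E → ℝ≥0, Measurable L ∧ P = Q.withDensity (fun x => (L x : ℝ≥0∞)) ∧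
    ∫⁻ x, (L x : ℝ≥0∞) ^ 2 ∂Q ≤ ENNReal.ofReal (Real.exp κ)

theorem lintegral_pi_prod {ι : Type*} [Fintype ι] {E : ι → Type*} [∀ i, MeasurableSpace (E i)]
    (Q : ∀ i, Measure (E i)) [∀ i, IsProbabilityMeasure (Q i)] (f : ∀ i, E i → ℝ≥0∞)
    (hf : ∀ i, Measurable (f i)) :
    ∫⁻ x, ∏ i, f i (x i) ∂Measure.pi Q = ∏ i, ∫⁻ y, f i y ∂Q i := by
  have hind : iIndepFun (fun i (x : ∀ i, E i) => f i (x i)) (Measure.pi Q) :=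
    iIndepFun_pi fun i => (hf i).aemeasurable
  rw [lintegral_prod_eq_prod_lintegral_of_indepFun Finset.univ _ hind
    (fun i => (hf i).comp (measurable_pi_apply i))]
  refine Finset.prod_congr rfl fun i _ => ?_
  exact (measurePreserving_eval Q i).lintegral_comp (hf i)

/-- The product of the densities is a density of the product, and by independence its second moment
is the product of the second moments, so the exponents add. -/
theorem HasSquareDensity.pi {ι : Type*} [Fintype ι] {E : ι → Type*} [∀ i, MeasurableSpace (E i)]
    {P Q : ∀ i, Measure (E i)} [∀ i, IsProbabilityMeasure (P i)] [∀ i, IsProbabilityMeasure (Q i)]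
    {κ : ℝ} (h : ∀ i, HasSquareDensity (P i) (Q i) κ) :
    HasSquareDensity (Measure.pi P) (Measure.pi Q) (Fintype.card ι * κ) := by
  choose L hL hP hK using h
  refine ⟨fun x => ∏ i, L i (x i), ?_, ?_, ?_⟩
  · exact Finset.measurable_prod _ fun i _ => (hL i).comp (measurable_pi_apply i)
  · symm
    refine (Measure.pi_eq fun s hs => ?_).symm
    rw [withDensity_apply _ (MeasurableSet.univ_pi hs), ← lintegral_indicator
      (MeasurableSet.univ_pi hs)]
    have : ∀ x : ∀ i, E i, (Set.univ.pi s).indicator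
        (fun x => ((∏ i, L i (x i) : ℝ≥0) : ℝ≥0∞)) x =
        ∏ i, (s i).indicator (fun y => (L i y : ℝ≥0∞)) (x i) := by
      intro x
      by_cases hx : x ∈ Set.univ.pi s
      · rw [Set.indicator_of_mem hx, ENNReal.ofNNReal_finsetProd]
        exact Finset.prod_congr rfl fun i _ =>
          (Set.indicator_of_mem (hx i (Set.mem_univ i)) (fun y => (L i y : ℝ≥0∞))).symm
      · rw [Set.indicator_of_notMem hx]
        simp only [Set.mem_univ_pi, not_forall] at hx
        obtain ⟨i, hi⟩ := hx
        exact (Finset.prod_eq_zero (Finset.mem_univ i) (Set.indicator_of_notMem hi _)).symm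
    simp_rw [this]
    rw [lintegral_pi_prod Q _ fun i => (hL i).coe_nnreal_ennreal.indicator (hs i)]
    refine Finset.prod_congr rfl fun i _ => ?_
    rw [lintegral_indicator (hs i), hP i, withDensity_apply _ (hs i)]
  · simp_rw [ENNReal.ofNNReal_finsetProd, ← Finset.prod_pow]
    rw [lintegral_pi_prod Q (fun i y => (L i y : ℝ≥0∞) ^ 2)
      fun i => (hL i).coe_nnreal_ennreal.pow_const 2]
    calc ∏ i, ∫⁻ y, (L i y : ℝ≥0∞) ^ 2 ∂Q i
        ≤ ∏ _i : ι, ENNReal.ofReal (Real.exp κ) := Finset.prod_le_prod' fun i _ => hK i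
      _ = ENNReal.ofReal (Real.exp (Fintype.card ι * κ)) := by
        rw [Finset.prod_const, Finset.card_univ, ← ENNReal.ofReal_pow (Real.exp_nonneg _),
          ← Real.exp_nat_mul]

/-- The real form of a square density: `L` is integrable with integral one, and its square is
integrable. -/
theorem HasSquareDensity.exists_real {E : Type*} [MeasurableSpace E] {P Q : Measure E} {κ : ℝ}
    [IsProbabilityMeasure P] [IsProbabilityMeasure Q] (h : HasSquareDensity P Q κ) :
    ∃ L : E → ℝ, Measurable L ∧ (∀ x, 0 ≤ L x) ∧ Integrable (fun x => L x ^ 2) Q ∧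
      ∫ x, L x ^ 2 ∂Q ≤ Real.exp κ ∧ Integrable L Q ∧ ∫ x, L x ∂Q = 1 ∧
      ∀ g : E → ℝ, ∫ x, g x ∂P = ∫ x, L x * g x ∂Q := by
  obtain ⟨L, hL, hP, hK⟩ := h
  have hsq : ∀ x, ENNReal.ofReal ((L x : ℝ) ^ 2) = (L x : ℝ≥0∞) ^ 2 := fun x => by
    rw [ENNReal.ofReal_pow (NNReal.coe_nonneg _), ENNReal.ofReal_coe_nnreal]
  have hmeas : Measurable fun x => (L x : ℝ) := hL.coe_nnreal_real
  have hint : Integrable (fun x => (L x : ℝ) ^ 2) Q := by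
    refine ⟨(hmeas.pow_const 2).aestronglyMeasurable, ?_⟩
    rw [hasFiniteIntegral_iff_ofReal (Filter.Eventually.of_forall fun x => sq_nonneg _)]
    simp_rw [hsq]
    exact hK.trans_lt ENNReal.ofReal_lt_top
  have hg : ∀ g : E → ℝ, ∫ x, g x ∂P = ∫ x, (L x : ℝ) * g x ∂Q := by
    intro g
    rw [hP, integral_withDensity_eq_integral_smul hL]
    rfl
  refine ⟨fun x => L x, hmeas, fun x => NNReal.coe_nonneg _, hint, ?_, ?_, ?_, hg⟩
  · rw [integral_eq_lintegral_of_nonneg_ae (Filter.Eventually.of_forall fun x => sq_nonneg _)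
      hint.aestronglyMeasurable]
    simp_rw [hsq]
    exact ENNReal.toReal_le_of_le_ofReal (Real.exp_nonneg _) hK
  · exact ((memLp_two_iff_integrable_sq hmeas.aestronglyMeasurable).2 hint).integrable one_le_two
  · simpa using (hg fun _ => 1).symm

/-- Change of measure for a bounded function, in the form of Young's inequality. -/
theorem HasSquareDensity.integral_le {E : Type*} [MeasurableSpace E] {P Q : Measure E} {κ : ℝ}
    [IsProbabilityMeasure P] [IsProbabilityMeasure Q] (h : HasSquareDensity P Q κ) {g : E → ℝ}
    (hg : Measurable g) {C : ℝ} (hC : ∀ x, |g x| ≤ C) {α : ℝ} (hα : 0 < α) :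
    ∫ x, g x ∂P ≤ α / 2 * Real.exp κ + 1 / (2 * α) * ∫ x, g x ^ 2 ∂Q := by
  obtain ⟨L, hL, hL0, hL2, hLκ, hLi, hL1, hLg⟩ := h.exists_real
  have hgi : Integrable (fun x => g x ^ 2) Q :=
    .of_bound (hg.pow_const 2).aestronglyMeasurable (C ^ 2) <| .of_forall fun x => by
      rw [Real.norm_eq_abs, abs_pow]
      exact pow_le_pow_left₀ (abs_nonneg _) (hC x) 2
  calc ∫ x, g x ∂P = ∫ x, L x * g x ∂Q := hLg g
    _ ≤ ∫ x, (α / 2 * L x ^ 2 + 1 / (2 * α) * g x ^ 2) ∂Q := by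
      refine integral_mono (hLi.mul_bdd hg.aestronglyMeasurable (.of_forall hC))
        ((hL2.const_mul _).add (hgi.const_mul _)) fun x => ?_
      have h1 : 0 ≤ (α * L x - g x) ^ 2 / (2 * α) := by positivity
      have h2 : (α * L x - g x) ^ 2 / (2 * α) =
          α / 2 * L x ^ 2 + 1 / (2 * α) * g x ^ 2 - L x * g x := by
        field_simp
        ring
      simp only
      linarith
    _ = α / 2 * ∫ x, L x ^ 2 ∂Q + 1 / (2 * α) * ∫ x, g x ^ 2 ∂Q := by
      rw [integral_add (hL2.const_mul _) (hgi.const_mul _), integral_const_mul,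
        integral_const_mul]
    _ ≤ _ := by gcongr

/-- Centred change of measure for a bounded function, in the form of Young's inequality. -/
theorem HasSquareDensity.integral_sub_integral_le {E : Type*} [MeasurableSpace E]
    {P Q : Measure E} {κ : ℝ} [IsProbabilityMeasure P] [IsProbabilityMeasure Q]
    (h : HasSquareDensity P Q κ) {g : E → ℝ}
    (hg : Measurable g) {C : ℝ} (hC : ∀ x, |g x| ≤ C) {α : ℝ} (hα : 0 < α) :
    ∫ x, g x ∂P - ∫ x, g x ∂Q ≤
      α / 2 * (Real.exp κ - 1) + 1 / (2 * α) * ∫ x, g x ^ 2 ∂Q := by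
  obtain ⟨L, hL, hL0, hL2, hLκ, hLi, hL1, hLg⟩ := h.exists_real
  have hgi : Integrable (fun x => g x ^ 2) Q :=
    .of_bound (hg.pow_const 2).aestronglyMeasurable (C ^ 2) <| .of_forall fun x => by
      rw [Real.norm_eq_abs, abs_pow]
      exact pow_le_pow_left₀ (abs_nonneg _) (hC x) 2
  have hgi1 : Integrable g Q := .of_bound hg.aestronglyMeasurable C (.of_forall hC)
  have hLg1 : Integrable (fun x => L x * g x) Q :=
    hLi.mul_bdd hg.aestronglyMeasurable (.of_forall hC)
  -- This is `(L - 1) ^ 2`, whose integral is at most `exp κ - 1`. Centring thus makes the error of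
  -- order `κ` for small `κ`.
  have hX : Integrable (fun x => L x ^ 2 - 2 * L x + 1) Q :=
    (hL2.sub (hLi.const_mul 2)).add (integrable_const 1)
  calc ∫ x, g x ∂P - ∫ x, g x ∂Q = ∫ x, (L x * g x - g x) ∂Q := by
        rw [hLg g, integral_sub hLg1 hgi1]
    _ ≤ ∫ x, (α / 2 * (L x ^ 2 - 2 * L x + 1) + 1 / (2 * α) * g x ^ 2) ∂Q := by
      refine integral_mono (hLg1.sub hgi1) ((hX.const_mul _).add (hgi.const_mul _)) fun x => ?_
      have h1 : 0 ≤ (α * (L x - 1) - g x) ^ 2 / (2 * α) := by positivity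
      have h2 : (α * (L x - 1) - g x) ^ 2 / (2 * α) =
          α / 2 * (L x ^ 2 - 2 * L x + 1) + 1 / (2 * α) * g x ^ 2 - (L x * g x - g x) := by
        field_simp
        ring
      simp only
      linarith
    _ = α / 2 * (∫ x, L x ^ 2 ∂Q - 1) + 1 / (2 * α) * ∫ x, g x ^ 2 ∂Q := by
      rw [integral_add (hX.const_mul _) (hgi.const_mul _), integral_const_mul,
        integral_const_mul, integral_add (f := fun x => L x ^ 2 - 2 * L x) (g := fun _ => 1)
          (hL2.sub (hLi.const_mul 2)) (integrable_const 1),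
        integral_sub hL2 (hLi.const_mul 2), integral_const_mul, hL1]
      simp only [integral_const, probReal_univ, smul_eq_mul]
      ring
    _ ≤ _ := by gcongr

/-! ### Total variation and integrals of bounded functions -/

/-- If `P` and `Q` differ by at most `ε` on every measurable set, then the integrals of a function
bounded by `T` differ by at most `2 T ε`. -/
theorem integral_sub_integral_le_of_forall_measureReal {E : Type*} [MeasurableSpace E]
    {P Q : Measure E} [IsProbabilityMeasure P] [IsProbabilityMeasure Q] {ε T : ℝ} (hT : 0 ≤ T)
    (h : ∀ B, MeasurableSet B → P.real B - Q.real B ≤ ε) {f : E → ℝ} (hf : Measurable f)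
    (hfT : ∀ x, |f x| ≤ T) :
    ∫ x, f x ∂P - ∫ x, f x ∂Q ≤ 2 * T * ε := by
  have hfm : Measurable fun x => f x + T := hf.add_const T
  have h0 : ∀ x, 0 ≤ f x + T := fun x => by linarith [neg_abs_le (f x), hfT x]
  have h1 : ∀ x, f x + T ≤ 2 * T := fun x => by linarith [le_abs_self (f x), hfT x]
  -- Layer-cake formula for `f + T`, which takes values in `[0, 2 T]`; the superlevel sets are then
  -- compared one by one.
  have key : ∀ (ν : Measure E) [IsProbabilityMeasure ν], Integrable f ν ∧
      (∫ x, f x ∂ν) + T = ∫ t in (0 : ℝ)..2 * T, ν.real {x | t ≤ f x + T} := by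
    intro ν _
    have hfi : Integrable f ν := .of_bound hf.aestronglyMeasurable T (.of_forall hfT)
    refine ⟨hfi, ?_⟩
    have := (hfi.add (integrable_const T)).integral_eq_integral_Ioc_meas_le
      (.of_forall h0) (M := 2 * T) (.of_forall h1)
    rw [intervalIntegral.integral_of_le (by linarith)]
    refine Eq.trans ?_ this
    simp only [Pi.add_apply]
    rw [integral_add hfi (integrable_const T)]
    simp
  have hint : ∀ (ν : Measure E) [IsProbabilityMeasure ν],
      IntervalIntegrable (fun t => ν.real {x | t ≤ f x + T}) volume 0 (2 * T) := by
    intro ν _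
    refine AntitoneOn.intervalIntegrable fun s _ t _ hst => ?_
    exact measureReal_mono fun x (hx : t ≤ f x + T) => hst.trans hx
  have hsub : ((∫ x, f x ∂P) + T) - ((∫ x, f x ∂Q) + T) ≤ 2 * T * ε := by
    rw [(key P).2, (key Q).2, ← intervalIntegral.integral_sub (hint P) (hint Q)]
    calc _ ≤ ∫ _t in (0 : ℝ)..2 * T, ε := by
          refine intervalIntegral.integral_mono_on (by linarith) ((hint P).sub (hint Q))
            intervalIntegrable_const fun t _ => ?_
          exact h _ (measurableSet_le measurable_const hfm)
      _ = 2 * T * ε := by simp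
  linarith

theorem measureReal_sub_le_tvDist {E : Type*} [MeasurableSpace E] (p q : ProbabilityMeasure E)
    {B : Set E} (hB : MeasurableSet B) :
    |(p : Measure E).real B - (q : Measure E).real B| ≤ tvDist p q := by
  refine le_ciSup (f := fun B : {B : Set E // MeasurableSet B} =>
    |(p : Measure E).real (B : Set E) - (q : Measure E).real (B : Set E)|) ⟨1, ?_⟩ ⟨B, hB⟩
  rintro _ ⟨C, rfl⟩
  have h1 : (p : Measure E).real (C : Set E) ≤ 1 := measureReal_le_one
  have h2 : (q : Measure E).real (C : Set E) ≤ 1 := measureReal_le_one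
  have h3 : 0 ≤ (p : Measure E).real (C : Set E) := measureReal_nonneg
  have h4 : 0 ≤ (q : Measure E).real (C : Set E) := measureReal_nonneg
  exact abs_le.2 ⟨by linarith, by linarith⟩

/-! ### Scaled Gaussians on the line -/

/-- The law of `s⁻¹ z` for a standard normal variable `z`. -/
noncomputable def scaledGaussian (s : ℝ) : Measure ℝ :=
  (gaussianReal 0 1).map fun z => s⁻¹ * z

instance isProbabilityMeasure_scaledGaussian (s : ℝ) :
    IsProbabilityMeasure (scaledGaussian s) :=
  Measure.isProbabilityMeasure_map (measurable_const_mul _).aemeasurable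

theorem scaledGaussian_eq_withDensity {s : ℝ} (hs : 0 < s) :
    scaledGaussian s = volume.withDensity fun x =>
      ENNReal.ofReal (s / √(2 * Real.pi) * Real.exp (-(s ^ 2 / 2) * x ^ 2)) := by
  have hv : NNReal.mk (s⁻¹ ^ 2) (sq_nonneg _) * 1 ≠ 0 := by
    rw [mul_one]
    exact fun h => (pow_pos (inv_pos.2 hs) 2).ne' (congrArg NNReal.toReal h)
  rw [scaledGaussian, gaussianReal_map_const_mul, gaussianReal_of_var_ne_zero _ hv]
  congr 1
  funext x
  rw [gaussianPDF, gaussianPDFReal]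
  congr 1
  simp only [mul_one, NNReal.coe_mk, mul_zero, sub_zero]
  congr 1
  · rw [Real.sqrt_mul (by positivity), Real.sqrt_sq (by positivity)]
    field_simp
  · congr 1
    field_simp

/-- The second moment is a Gaussian integral equal to `s² / (t √(2 s² - t²))`, finite because `2 s²
> t²` in this range. It is `1` at `s = t` and exceeds `1` only to second order in `s - t`. -/
theorem hasSquareDensity_scaledGaussian {s t D : ℝ} (hD : D ≤ 1 / 5) (hs : 1 ≤ s) (ht : 1 ≤ t)
    (hs' : s ≤ 1 + D) (ht' : t ≤ 1 + D) :
    HasSquareDensity (scaledGaussian s) (scaledGaussian t) (13 * D ^ 2) := by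
  have hs0 : 0 < s := by linarith
  have ht0 : 0 < t := by linarith
  have hD0 : 0 ≤ D := by linarith
  have hst : 14 / 25 ≤ 2 * s ^ 2 - t ^ 2 := by nlinarith
  have hb : 0 < s ^ 2 - t ^ 2 / 2 := by linarith
  have hLm : Measurable fun x : ℝ => s / t * Real.exp (-((s ^ 2 - t ^ 2) / 2) * x ^ 2) := by
    fun_prop
  have hL0 : ∀ x : ℝ, 0 ≤ s / t * Real.exp (-((s ^ 2 - t ^ 2) / 2) * x ^ 2) := fun x => by
    positivity
  have hpm : Measurable fun x : ℝ => ENNReal.ofReal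
      (t / √(2 * Real.pi) * Real.exp (-(t ^ 2 / 2) * x ^ 2)) := by fun_prop
  refine ⟨fun x => (s / t * Real.exp (-((s ^ 2 - t ^ 2) / 2) * x ^ 2)).toNNReal,
    hLm.real_toNNReal, ?_, ?_⟩
  · rw [scaledGaussian_eq_withDensity hs0, scaledGaussian_eq_withDensity ht0,
      ← withDensity_mul _ hpm hLm.real_toNNReal.coe_nnreal_ennreal]
    congr 1
    funext x
    rw [Pi.mul_apply]
    change _ = _ * ENNReal.ofReal _
    rw [← ENNReal.ofReal_mul (by positivity)]
    congr 1
    calc s / √(2 * Real.pi) * Real.exp (-(s ^ 2 / 2) * x ^ 2)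
        = s / √(2 * Real.pi) * Real.exp (-(t ^ 2 / 2) * x ^ 2 +
            -((s ^ 2 - t ^ 2) / 2) * x ^ 2) := by ring_nf
      _ = _ := by
        rw [Real.exp_add]
        field_simp
  · rw [scaledGaussian_eq_withDensity ht0, lintegral_withDensity_eq_lintegral_mul _ hpm
      (hLm.real_toNNReal.coe_nnreal_ennreal.pow_const 2)]
    have h1 : ∀ x : ℝ, ((fun x : ℝ => ENNReal.ofReal
        (t / √(2 * Real.pi) * Real.exp (-(t ^ 2 / 2) * x ^ 2))) * fun x : ℝ =>
        (((s / t * Real.exp (-((s ^ 2 - t ^ 2) / 2) * x ^ 2)).toNNReal : ℝ≥0) : ℝ≥0∞) ^ 2) x =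
        ENNReal.ofReal (s ^ 2 / (t * √(2 * Real.pi)) *
          Real.exp (-(s ^ 2 - t ^ 2 / 2) * x ^ 2)) := by
      intro x
      rw [Pi.mul_apply]
      change _ * ENNReal.ofReal _ ^ 2 = _
      rw [← ENNReal.ofReal_pow (hL0 x), ← ENNReal.ofReal_mul (by positivity)]
      congr 1
      rw [mul_pow, ← Real.exp_nat_mul, mul_mul_mul_comm, ← Real.exp_add]
      congr 1
      · field_simp
      · congr 1
        push_cast
        ring
    rw [lintegral_congr h1, ← ofReal_integral_eq_lintegral_ofReal
      ((integrable_exp_neg_mul_sq hb).const_mul _) (.of_forall fun x => by positivity),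
      integral_const_mul, integral_gaussian]
    refine ENNReal.ofReal_le_ofReal ?_
    refine le_trans ?_ (Real.add_one_le_exp _)
    have h2 : √(Real.pi / (s ^ 2 - t ^ 2 / 2)) = √(2 * Real.pi) / √(2 * s ^ 2 - t ^ 2) := by
      rw [← Real.sqrt_div (by positivity)]
      congr 1
      have : 2 * s ^ 2 - t ^ 2 ≠ 0 := by linarith
      field_simp
    have h3 : 0 < √(2 * s ^ 2 - t ^ 2) := Real.sqrt_pos.2 (by linarith)
    have h4 : s ^ 2 / (t * √(2 * Real.pi)) * √(Real.pi / (s ^ 2 - t ^ 2 / 2)) =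
        s ^ 2 / (t * √(2 * s ^ 2 - t ^ 2)) := by
      rw [h2]
      have : 0 < √(2 * Real.pi) := by positivity
      field_simp
    rw [h4, div_le_iff₀ (by positivity)]
    refine le_of_sq_le_sq ?_ (by positivity)
    rw [mul_pow, mul_pow, Real.sq_sqrt (by linarith)]
    -- After squaring, the excess to control is `s⁴ - t² (2 s² - t²) = (s² - t²)²`.
    have h5 : (s ^ 2 - t ^ 2) ^ 2 ≤ 13 * D ^ 2 * (t ^ 2 * (2 * s ^ 2 - t ^ 2)) := by
      have h6 : (s - t) ^ 2 ≤ D ^ 2 := sq_le_sq' (by linarith) (by linarith)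
      have h7 : (s + t) ^ 2 ≤ 6 := by nlinarith
      have h8 : 14 / 25 ≤ t ^ 2 * (2 * s ^ 2 - t ^ 2) := by nlinarith
      calc (s ^ 2 - t ^ 2) ^ 2 = (s - t) ^ 2 * (s + t) ^ 2 := by ring
        _ ≤ D ^ 2 * 6 := by gcongr
        _ ≤ 13 * D ^ 2 * (14 / 25) := by nlinarith [sq_nonneg D]
        _ ≤ _ := by gcongr
    have h9 : 0 ≤ t ^ 2 * (2 * s ^ 2 - t ^ 2) := mul_nonneg (sq_nonneg _) (by linarith)
    have h10 : 0 ≤ 13 * D ^ 2 := by positivity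
    nlinarith [mul_nonneg h10 h9, mul_nonneg (mul_nonneg h10 h10) h9]

theorem scaledGaussian_real_Ioi {s : ℝ} (hs : 0 < s) :
    (scaledGaussian s).real (Set.Ioi 1) = (gaussianReal 0 1).real (Set.Ioi s) := by
  rw [scaledGaussian, map_measureReal_apply (measurable_const_mul _) measurableSet_Ioi]
  congr 1
  ext z
  simp only [Set.mem_preimage, Set.mem_Ioi]
  rw [inv_mul_eq_div, one_lt_div hs]

/-- The upper tail of `s⁻¹ z` decreases at a definite rate in `s`. -/
theorem scaledGaussian_real_Ioi_sub {s t : ℝ} (hs : 1 ≤ s) (hst : s ≤ t) (ht : t ≤ 6 / 5) :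
    (t - s) / 10 ≤
      (scaledGaussian s).real (Set.Ioi 1) - (scaledGaussian t).real (Set.Ioi 1) := by
  rw [scaledGaussian_real_Ioi (by linarith), scaledGaussian_real_Ioi (by linarith),
    ← measureReal_sdiff (Set.Ioi_subset_Ioi hst) measurableSet_Ioi, Set.Ioi_sdiff_Ioi]
  -- On this range the density is at least `5/14 * 7/25 = 1/10`.
  have hpdf : ∀ x ∈ Set.Ioc s t, (1 / 10 : ℝ) ≤ gaussianPDFReal 0 1 x := by
    intro x hx
    rw [gaussianPDFReal]
    simp only [NNReal.coe_one, mul_one, sub_zero]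
    have h1 : √(2 * Real.pi) ≤ 14 / 5 := by
      rw [Real.sqrt_le_left (by norm_num)]
      nlinarith [Real.pi_lt_d2]
    have h2 : (14 / 5 : ℝ)⁻¹ ≤ (√(2 * Real.pi))⁻¹ := inv_anti₀ (by positivity) h1
    have h3 : (7 / 25 : ℝ) ≤ Real.exp (-x ^ 2 / 2) := by
      refine le_trans ?_ (Real.add_one_le_exp _)
      have : x ^ 2 ≤ (6 / 5) ^ 2 := pow_le_pow_left₀ (by linarith [hx.1]) (hx.2.trans ht) 2
      linarith
    calc (1 / 10 : ℝ) = (14 / 5 : ℝ)⁻¹ * (7 / 25) := by norm_num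
      _ ≤ _ := by gcongr
  rw [measureReal_def, gaussianReal_apply_eq_integral 0 one_ne_zero,
    ENNReal.toReal_ofReal (integral_nonneg fun x => gaussianPDFReal_nonneg 0 1 x)]
  calc (t - s) / 10 = ∫ _x in Set.Ioc s t, (1 / 10 : ℝ) := by
        simp [hst]
        ring
    _ ≤ _ := by
      refine setIntegral_mono_on (by simp) (integrable_gaussianPDFReal 0 1).integrableOn
        measurableSet_Ioc hpdf

/-! ### Fourth moments and truncation -/

/-- Fourth moment of a sum of independent centred variables with values in unit intervals. -/
theorem integral_sum_pow_four_le {ι : Type*} [Fintype ι] [Nonempty ι] {E : ι → Type*}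
    [∀ i, MeasurableSpace (E i)] (Q : ∀ i, Measure (E i)) [∀ i, IsProbabilityMeasure (Q i)]
    {b : ∀ i, E i → ℝ} (hb : ∀ i, Measurable (b i)) {m : ι → ℝ}
    (hm : ∀ i y, b i y ∈ Set.Icc (m i) (m i + 1)) (h0 : ∀ i, ∫ y, b i y ∂Q i = 0) :
    ∫ x, (∑ i, b i (x i)) ^ 4 ∂Measure.pi Q ≤ 6 * (Fintype.card ι : ℝ) ^ 2 := by
  have hcard : (0 : ℝ) < Fintype.card ι := by exact_mod_cast Fintype.card_pos
  have hsub : HasSubgaussianMGF (fun x : ∀ i, E i => ∑ i, b i (x i))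
      (∑ _i : ι, (1 / 2 : ℝ≥0) ^ 2) (Measure.pi Q) := by
    refine HasSubgaussianMGF.sum_of_iIndepFun (X := fun i (x : ∀ i, E i) => b i (x i))
      (iIndepFun_pi fun i => (hb i).aemeasurable) fun i _ => ?_
    have := hasSubgaussianMGF_of_mem_Icc_of_integral_eq_zero (μ := Measure.pi Q)
      (X := fun x => b i (x i)) (a := m i) (b := m i + 1)
      ((hb i).comp (measurable_pi_apply i)).aemeasurable (.of_forall fun x => hm i (x i))
      ((integral_comp_eval (hb i).aestronglyMeasurable).trans (h0 i))
    simpa using this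
  set S : (∀ i, E i) → ℝ := fun x => ∑ i, b i (x i) with hS
  set d : ℝ := ((Fintype.card ι : ℕ) : ℝ)
  -- By Hoeffding's lemma the sum is sub-Gaussian with variance proxy `d / 4`; this `t` makes the
  -- bound on the moment generating function `exp (1/2) ≤ 2`.
  set t : ℝ := 2 / √d with ht
  have hsd : 0 < √d := Real.sqrt_pos.2 hcard
  have ht0 : 0 < t := by positivity
  have ht2 : t ^ 2 = 4 / d := by
    rw [ht, div_pow, Real.sq_sqrt hcard.le]
    norm_num
  have hexp : Real.exp (1 / 2) ≤ 2 := by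
    rw [← Real.le_log_iff_exp_le (by norm_num)]
    linarith [Real.log_two_gt_d9]
  have hmgf : ∀ u : ℝ, u ^ 2 = t ^ 2 → ∫ x, Real.exp (u * S x) ∂Measure.pi Q ≤ 2 := by
    intro u hu
    refine (hsub.mgf_le u).trans (le_trans (Real.exp_le_exp.2 (le_of_eq ?_)) hexp)
    rw [hu, ht2]
    simp only [Finset.sum_const, Finset.card_univ, nsmul_eq_mul]
    push_cast
    change (d * (1 / 2) ^ 2) * (4 / d) / 2 = 1 / 2
    field_simp
    norm_num
  have hpt : ∀ x, S x ^ 4 ≤ 24 / t ^ 4 * (Real.exp (t * S x) + Real.exp (-t * S x)) := by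
    intro x
    have h1 : |t * S x| ^ 4 / (Nat.factorial 4 : ℕ) ≤ Real.exp |t * S x| :=
      Real.pow_div_factorial_le_exp _ (abs_nonneg _) 4
    have h2 : Real.exp |t * S x| ≤ Real.exp (t * S x) + Real.exp (-t * S x) := by
      rw [neg_mul]
      rcases abs_choice (t * S x) with h | h <;> rw [h] <;>
        linarith [Real.exp_pos (t * S x), Real.exp_pos (-(t * S x))]
    have h3 : |t * S x| ^ 4 = t ^ 4 * S x ^ 4 := by
      rw [(by decide : Even 4).pow_abs, mul_pow]
    have h4 : (Nat.factorial 4 : ℕ) = 24 := rfl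
    rw [h3, h4, div_le_iff₀ (by norm_num)] at h1
    push_cast at h1
    rw [div_mul_eq_mul_div, le_div_iff₀ (by positivity)]
    linarith
  have hi1 := hsub.integrable_exp_mul t
  have hi2 := hsub.integrable_exp_mul (-t)
  calc ∫ x, S x ^ 4 ∂Measure.pi Q
      ≤ ∫ x, 24 / t ^ 4 * (Real.exp (t * S x) + Real.exp (-t * S x)) ∂Measure.pi Q :=
        integral_mono_of_nonneg (.of_forall fun x => by positivity)
          ((hi1.add hi2).const_mul _) (.of_forall hpt)
    _ = 24 / t ^ 4 * (∫ x, Real.exp (t * S x) ∂Measure.pi Q +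
          ∫ x, Real.exp (-t * S x) ∂Measure.pi Q) := by
        rw [integral_const_mul, integral_add hi1 hi2]
    _ ≤ 24 / t ^ 4 * (2 + 2) := by
        gcongr
        · exact hmgf t rfl
        · exact hmgf (-t) (by ring)
    _ = 6 * d ^ 2 := by
        rw [show t ^ 4 = (t ^ 2) ^ 2 by ring, ht2]
        field_simp
        norm_num

/-- The error made by truncating at level `T` is quadratic. -/
theorem sq_sub_clip_le {T : ℝ} (hT : 0 < T) (x : ℝ) :
    (x - max (-T) (min T x)) ^ 2 ≤ x ^ 4 / (16 * T ^ 2) := by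
  -- From `(|x| - 2 T)² ≥ 0` one gets `|x| - T ≤ x² / (4 T)`.
  have key : |x - max (-T) (min T x)| ≤ x ^ 2 / (4 * T) := by
    rw [le_div_iff₀ (by positivity)]
    rcases le_total x T with h | h
    · rw [min_eq_right h]
      rcases le_total (-T) x with h' | h'
      · rw [max_eq_right h', sub_self, abs_zero, zero_mul]
        positivity
      · rw [max_eq_left h', abs_of_nonpos (by linarith)]
        nlinarith [sq_nonneg (x + 2 * T)]
    · rw [min_eq_left h, max_eq_right (by linarith), abs_of_nonneg (by linarith)]
      nlinarith [sq_nonneg (x - 2 * T)]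
  calc (x - max (-T) (min T x)) ^ 2 = |x - max (-T) (min T x)| ^ 2 := (sq_abs _).symm
    _ ≤ (x ^ 2 / (4 * T)) ^ 2 := by gcongr
    _ = _ := by
      rw [div_pow, mul_pow]
      ring

theorem abs_sub_clip_le {T : ℝ} (hT : 0 < T) (x : ℝ) :
    |x - max (-T) (min T x)| ≤ |x| := by
  rcases le_total x T with h | h
  · rw [min_eq_right h]
    rcases le_total (-T) x with h' | h'
    · rw [max_eq_right h', sub_self, abs_zero]
      positivity
    · rw [max_eq_left h', abs_of_nonpos (by linarith), abs_of_nonpos (by linarith)]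
      linarith
  · rw [min_eq_left h, max_eq_right (by linarith), abs_of_nonneg (by linarith),
      abs_of_nonneg (by linarith)]
    linarith

/-! ### Separation in total variation -/

/-- The law of a vector with independent coordinates `(s i)⁻¹ z i`. -/
noncomputable def scaledGaussianPi {d : ℕ} (s : Fin d → ℝ) : Measure (Fin d → ℝ) :=
  Measure.pi fun i => scaledGaussian (s i)

instance isProbabilityMeasure_scaledGaussianPi {d : ℕ} (s : Fin d → ℝ) :
    IsProbabilityMeasure (scaledGaussianPi s) := by
  unfold scaledGaussianPi
  infer_instance

theorem hasSquareDensity_scaledGaussianPi {d : ℕ} {s t : Fin d → ℝ} {δ : ℝ}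
    (hδ : 16 * δ ≤ 1 / 5) (hs : ∀ i, s i ∈ Set.Icc 1 (1 + 16 * δ))
    (ht : ∀ i, t i ∈ Set.Icc 1 (1 + 16 * δ)) :
    HasSquareDensity (scaledGaussianPi s) (scaledGaussianPi t) (3328 * d * δ ^ 2) := by
  have := HasSquareDensity.pi fun i => hasSquareDensity_scaledGaussian hδ (hs i).1 (ht i).1
    (hs i).2 (ht i).2
  rw [Fintype.card_fin] at this
  rwa [show 3328 * d * δ ^ 2 = d * (13 * (16 * δ) ^ 2) by ring]

/-- Two rectified Gaussians with diagonal weights that differ in a quarter of the coordinates are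
far apart in total variation. -/
theorem exists_measureReal_sub_gt {d : ℕ} (hd : 0 < d) {s t : Fin d → ℝ} {δ ε : ℝ} (hδ0 : 0 < δ)
    (hδ : 16 * δ ≤ 1 / 5) (hdδ : 3328 * d * δ ^ 2 ≤ 1) (hε : 1280000 * ε < √d * δ)
    (hs : ∀ i, s i ∈ Set.Icc 1 (1 + 16 * δ)) (ht : ∀ i, t i ∈ Set.Icc 1 (1 + 16 * δ))
    (hst : d ≤ 4 * (Finset.univ.filter fun i => δ ≤ |s i - t i|).card) :
    ∃ B, MeasurableSet B ∧
      2 * ε < ((scaledGaussianPi s).map fun y i => max (y i) 0).real B -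
        ((scaledGaussianPi t).map fun y i => max (y i) 0).real B := by
  by_contra! hcon
  have hne : Nonempty (Fin d) := ⟨⟨0, hd⟩⟩
  have hd' : (0 : ℝ) < d := by exact_mod_cast hd
  have hR : Measurable fun (y : Fin d → ℝ) i => max (y i) 0 :=
    measurable_pi_lambda _ fun i => (measurable_pi_apply i).max measurable_const
  have hPR := Measure.isProbabilityMeasure_map (μ := scaledGaussianPi s) hR.aemeasurable
  have hQR := Measure.isProbabilityMeasure_map (μ := scaledGaussianPi t) hR.aemeasurable
  -- The upper tail decreases in the scale, so these signs make every differing coordinate raise the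
  -- mean under `s` above that under `t`.
  set a : Fin d → ℝ := fun i => if δ ≤ |s i - t i| then (if s i < t i then 1 else -1) else 0
    with ha
  set p : Fin d → ℝ := fun i => (scaledGaussian (t i)).real (Set.Ioi 1) with hp
  set bit : ℝ → ℝ := (Set.Ioi 1).indicator fun _ => (1 : ℝ) with hbit
  have hbitm : Measurable bit := measurable_const.indicator measurableSet_Ioi
  have hbit01 : ∀ y, 0 ≤ bit y ∧ bit y ≤ 1 := fun y =>
    ⟨Set.indicator_nonneg (fun _ _ => zero_le_one) y,
      Set.indicator_le_self' (fun _ _ => zero_le_one) y⟩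
  -- The threshold `1` is positive, so the test does not see the rectification.
  have hbitR : ∀ y : ℝ, bit (max y 0) = bit y := by
    intro y
    have : ¬ (1 : ℝ) < 0 := not_lt.2 zero_le_one
    simp [hbit, Set.indicator_apply, this]
  have hbitint : ∀ r, ∫ y, bit y ∂scaledGaussian r = (scaledGaussian r).real (Set.Ioi 1) :=
    fun r => by
      rw [hbit, integral_indicator_const _ measurableSet_Ioi]
      simp
  have hbiti : ∀ r, Integrable bit (scaledGaussian r) := fun r =>
    (integrable_const (1 : ℝ)).indicator measurableSet_Ioi
  have hp01 : ∀ i, 0 ≤ p i ∧ p i ≤ 1 := fun i => ⟨measureReal_nonneg, measureReal_le_one⟩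
  set b : Fin d → ℝ → ℝ := fun i y => a i * (bit y - p i) with hb
  have hbm : ∀ i, Measurable (b i) := fun i => (hbitm.sub_const _).const_mul _
  have hbI : ∀ i y, b i y ∈ Set.Icc (min (a i) 0 - a i * p i) (min (a i) 0 - a i * p i + 1) := by
    intro i y
    have := hbit01 y
    simp only [hb, ha]
    constructor <;> split_ifs <;> norm_num <;> linarith
  have ha1 : ∀ i, |a i| ≤ 1 := by
    intro i
    simp only [ha]
    split_ifs <;> norm_num
  have hb1 : ∀ i y, |b i y| ≤ 1 := by
    intro i y
    have h1 : |bit y - p i| ≤ 1 := abs_le.2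
      ⟨by linarith [(hbit01 y).1, (hp01 i).2], by linarith [(hbit01 y).2, (hp01 i).1]⟩
    simp only [hb, abs_mul]
    exact mul_le_one₀ (ha1 i) (abs_nonneg _) h1
  have hbint : ∀ i r, ∫ y, b i y ∂scaledGaussian r =
      a i * ((scaledGaussian r).real (Set.Ioi 1) - p i) := by
    intro i r
    simp only [hb]
    rw [integral_const_mul, integral_sub (hbiti r) (integrable_const _), hbitint]
    simp
  set S : (Fin d → ℝ) → ℝ := fun x => ∑ i, b i (x i) with hS
  have hSm : Measurable S :=
    Finset.measurable_sum _ fun i _ => (hbm i).comp (measurable_pi_apply i)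
  have hSd : ∀ x, |S x| ≤ d := fun x => by
    calc |S x| ≤ ∑ i, |b i (x i)| := Finset.abs_sum_le_sum_abs _ _
      _ ≤ ∑ _i : Fin d, (1 : ℝ) := Finset.sum_le_sum fun i _ => hb1 i _
      _ = d := by simp
  have hSR : ∀ x, S (fun i => max (x i) 0) = S x := fun x => by
    simp only [hS, hb, hbitR]
  have hSint : ∀ r : Fin d → ℝ, Integrable S (scaledGaussianPi r) ∧
      ∫ x, S x ∂scaledGaussianPi r =
        ∑ i, a i * ((scaledGaussian (r i)).real (Set.Ioi 1) - p i) := by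
    intro r
    refine ⟨.of_bound hSm.aestronglyMeasurable d (.of_forall hSd), ?_⟩
    rw [hS, integral_finsetSum]
    · refine Finset.sum_congr rfl fun i _ => ?_
      rw [← hbint i (r i)]
      exact integral_comp_eval (hbm i).aestronglyMeasurable
    · exact fun i _ => .of_bound
        ((hbm i).comp (measurable_pi_apply i)).aestronglyMeasurable 1
        (.of_forall fun x => hb1 i (x i))
  have hdiff : d * δ / 40 ≤ ∫ x, S x ∂scaledGaussianPi s - ∫ x, S x ∂scaledGaussianPi t := by
    rw [(hSint s).2, (hSint t).2, ← Finset.sum_sub_distrib]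
    have hterm : ∀ i, (if δ ≤ |s i - t i| then δ / 10 else 0) ≤
        a i * ((scaledGaussian (s i)).real (Set.Ioi 1) - p i) -
          a i * ((scaledGaussian (t i)).real (Set.Ioi 1) - p i) := by
      intro i
      have hs2 : s i ≤ 6 / 5 := (hs i).2.trans (by linarith)
      have ht2 : t i ≤ 6 / 5 := (ht i).2.trans (by linarith)
      simp only [ha]
      split_ifs with h1 h2
      · have := scaledGaussian_real_Ioi_sub (hs i).1 h2.le ht2
        rw [abs_of_neg (by linarith)] at h1
        linarith
      · have := scaledGaussian_real_Ioi_sub (ht i).1 (not_lt.1 h2) hs2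
        rw [abs_of_nonneg (by linarith)] at h1
        linarith
      · simp
    refine le_trans ?_ (Finset.sum_le_sum fun i _ => hterm i)
    rw [← Finset.sum_filter, Finset.sum_const, nsmul_eq_mul]
    have : (d : ℝ) ≤ 4 * ((Finset.univ.filter fun i => δ ≤ |s i - t i|).card : ℝ) := by
      exact_mod_cast hst
    nlinarith
  have hfour : ∫ x, S x ^ 4 ∂scaledGaussianPi t ≤ 6 * (d : ℝ) ^ 2 := by
    have := integral_sum_pow_four_le (fun i => scaledGaussian (t i)) hbm hbI fun i => by
      rw [hbint]
      simp [hp]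
    rwa [Fintype.card_fin] at this
  have hsd : 0 < √(d : ℝ) := Real.sqrt_pos.2 hd'
  have hsd2 : √(d : ℝ) ^ 2 = d := Real.sq_sqrt hd'.le
  -- Truncation at the scale of the fluctuations: the bounded part of the mean shift is at most `4 T
  -- ε`, and the constant is large enough for the tails to absorb only half of the shift `d δ / 40`.
  set T : ℝ := 4000 * √d with hT
  have hT0 : 0 < T := by positivity
  have hT2 : T ^ 2 = 16000000 * d := by
    rw [hT, mul_pow, hsd2]
    norm_num
  set f : (Fin d → ℝ) → ℝ := fun x => max (-T) (min T (S x)) with hf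
  have hfm : Measurable f := measurable_const.max (measurable_const.min hSm)
  have hfT : ∀ x, |f x| ≤ T := fun x =>
    abs_le.2 ⟨le_max_left _ _, max_le (by linarith) (min_le_left _ _)⟩
  have hfR : ∀ x, f (fun i => max (x i) 0) = f x := fun x => by
    simp only [hf, hSR]
  have hfi : ∀ r, Integrable f (scaledGaussianPi r) := fun r =>
    .of_bound hfm.aestronglyMeasurable T (.of_forall hfT)
  have hupper : ∫ x, f x ∂scaledGaussianPi s - ∫ x, f x ∂scaledGaussianPi t ≤
      2 * T * (2 * ε) := by
    have := integral_sub_integral_le_of_forall_measureReal hT0.le hcon hfm hfT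
    rw [integral_map hR.aemeasurable hfm.aestronglyMeasurable,
      integral_map hR.aemeasurable hfm.aestronglyMeasurable] at this
    simpa only [hfR] using this
  have htail : ∫ x, (S x - f x) ∂scaledGaussianPi s - ∫ x, (S x - f x) ∂scaledGaussianPi t ≤
      d * δ / 80 := by
    -- Since `532480 = 160 * 3328`, the first Young term is at most `d δ / 160`; the fourth-moment
    -- term comes out just below `d δ / 160` as well.
    have h1 := (hasSquareDensity_scaledGaussianPi hδ hs ht).integral_sub_integral_le
      (hSm.sub hfm) (fun x => (abs_sub_clip_le hT0 (S x)).trans (hSd x))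
      (α := 1 / (532480 * δ)) (by positivity)
    refine h1.trans ?_
    have h2 : Real.exp (3328 * d * δ ^ 2) - 1 ≤ 2 * (3328 * d * δ ^ 2) := by
      have h3 : 0 ≤ 3328 * d * δ ^ 2 := by positivity
      have := Real.abs_exp_sub_one_le (x := 3328 * d * δ ^ 2) (by rwa [abs_of_nonneg h3])
      rw [abs_of_nonneg h3] at this
      exact (le_abs_self _).trans this
    have h4 : ∫ x, (S - f) x ^ 2 ∂scaledGaussianPi t ≤ 6 * (d : ℝ) ^ 2 / (16 * T ^ 2) := by
      calc ∫ x, (S - f) x ^ 2 ∂scaledGaussianPi t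
          ≤ ∫ x, S x ^ 4 / (16 * T ^ 2) ∂scaledGaussianPi t := by
            refine integral_mono_of_nonneg (.of_forall fun x => sq_nonneg _) ?_
              (.of_forall fun x => sq_sub_clip_le hT0 (S x))
            refine Integrable.div_const (.of_bound (hSm.pow_const 4).aestronglyMeasurable
              ((d : ℝ) ^ 4) (.of_forall fun x => ?_)) _
            rw [Real.norm_eq_abs, abs_pow]
            exact pow_le_pow_left₀ (abs_nonneg _) (hSd x) 4
        _ ≤ _ := by
            rw [integral_div]
            gcongr
    calc _ ≤ 1 / (532480 * δ) / 2 * (2 * (3328 * d * δ ^ 2)) +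
          1 / (2 * (1 / (532480 * δ))) * (6 * (d : ℝ) ^ 2 / (16 * T ^ 2)) := by
          refine add_le_add (mul_le_mul_of_nonneg_left h2 (by positivity))
            (mul_le_mul_of_nonneg_left h4 (by positivity))
      _ = d * δ * (1 / 160 + 6 * 532480 / 512000000) := by
          rw [hT2]
          field_simp
          norm_num
      _ ≤ d * δ * (1 / 80) := by
          gcongr
          norm_num
      _ = _ := by ring
  rw [integral_sub (hSint s).1 (hfi s), integral_sub (hSint t).1 (hfi t)] at htail
  have hlow : d * δ / 80 ≤ 16000 * √d * ε := by
    calc d * δ / 80 ≤ 2 * T * (2 * ε) := by linarith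
      _ = _ := by
        rw [hT]
        ring
  have : √(d : ℝ) * (√d * δ) ≤ √(d : ℝ) * (1280000 * ε) := by
    calc √(d : ℝ) * (√d * δ) = √(d : ℝ) ^ 2 * δ := by ring
      _ = d * δ := by rw [hsd2]
      _ ≤ _ := by linarith
  exact absurd (le_of_mul_le_mul_left this hsd) (not_le.2 hε)

/-! ### Counting nearby words and identification -/

/-- Few words over an alphabet of 16 letters agree with a given one in three quarters of the
coordinates. -/
theorem card_filter_hamming_lt_le {d : ℕ} (w : Fin d → Fin 16) :
    ((Finset.univ.filter fun v : Fin d → Fin 16 =>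
      4 * (Finset.univ.filter fun i => v i ≠ w i).card < d).card : ℝ) ≤ 4 ^ d := by
  -- Chernoff-type weights: each coordinate sums to `1 + 15/16 ≤ 2`, while a word with fewer than `d
  -- / 4` disagreements has weight at least `16 ^ (-d / 4) = 2 ^ (-d)`.
  set g : Fin d → Fin 16 → ℝ := fun i a => if a ≠ w i then 1 / 16 else 1 with hg
  have hg0 : ∀ i a, 0 ≤ g i a := fun i a => by
    simp only [hg]
    split_ifs <;> norm_num
  have hsum : ∑ v : Fin d → Fin 16, ∏ i, g i (v i) ≤ 2 ^ d := by
    have h1 : ∏ i, ∑ a, g i a = ∑ v : Fin d → Fin 16, ∏ i, g i (v i) := by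
      rw [Finset.prod_univ_sum, Fintype.piFinset_univ]
    rw [← h1]
    calc ∏ i, ∑ a, g i a ≤ ∏ _i : Fin d, (2 : ℝ) := by
          refine Finset.prod_le_prod (fun i _ => Finset.sum_nonneg fun a _ => hg0 i a)
            fun i _ => ?_
          have h2 : ∀ a, g i a ≤ 1 / 16 + if a = w i then 1 else 0 := fun a => by
            by_cases h : a = w i <;> simp [hg, h]
          calc ∑ a, g i a ≤ ∑ a, ((1 / 16 : ℝ) + if a = w i then 1 else 0) :=
                Finset.sum_le_sum fun a _ => h2 a
            _ = 2 := by
                rw [Finset.sum_add_distrib, Finset.sum_ite_eq']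
                norm_num
      _ = 2 ^ d := by simp
  have hlow : ∀ v ∈ Finset.univ.filter fun v : Fin d → Fin 16 =>
      4 * (Finset.univ.filter fun i => v i ≠ w i).card < d, (1 / 2 : ℝ) ^ d ≤ ∏ i, g i (v i) := by
    intro v hv
    simp only [Finset.mem_filter, Finset.mem_univ, true_and] at hv
    have h1 : ∏ i, g i (v i) = (1 / 16) ^ (Finset.univ.filter fun i => v i ≠ w i).card := by
      simp only [hg]
      rw [Finset.prod_ite, Finset.prod_const, Finset.prod_const_one, mul_one]
    rw [h1, show (1 / 16 : ℝ) = (1 / 2) ^ 4 by norm_num, ← pow_mul]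
    exact pow_le_pow_of_le_one (by norm_num) (by norm_num) hv.le
  have h3 := Finset.card_nsmul_le_sum _ _ _ hlow
  have h4 := h3.trans ((Finset.sum_le_univ_sum_of_nonneg fun v =>
    Finset.prod_nonneg fun i _ => hg0 i (v i)).trans hsum)
  rw [nsmul_eq_mul, one_div, inv_pow, ← div_eq_mul_inv, div_le_iff₀ (by positivity),
    ← mul_pow] at h4
  norm_num at h4 ⊢
  exact h4

/-- A change-of-measure bound for identification: if all `P v` are close to one `Q`, and no point
lies in more than `N` of the sets `G v`, then a procedure that hits `G v` under each `P v` with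
probability `2/3` forces the number of hypotheses to be small. -/
theorem card_le_of_forall_bind_ge {V E E' F : Type*} [Fintype V] [Nonempty V]
    [MeasurableSpace E] [MeasurableSpace E'] [MeasurableSpace F] {P : V → Measure E}
    {Q : Measure E} [∀ v, IsProbabilityMeasure (P v)] [IsProbabilityMeasure Q] {κ : ℝ}
    (hPQ : ∀ v, HasSquareDensity (P v) Q κ) {R : E → E'} (hR : Measurable R) (A : Kernel E' F)
    [IsMarkovKernel A] {G : V → Set F} (hG : ∀ v, MeasurableSet (G v)) {N : ℝ}
    (hN : ∀ q, ∑ v, (G v).indicator (fun _ => (1 : ℝ)) q ≤ N)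
    (hA : ∀ v, 2 / 3 ≤ (((P v).map R).bind A).real (G v)) :
    4 / 9 * Fintype.card V ≤ Real.exp κ * N := by
  set g : V → E → ℝ := fun v x => (A (R x)).real (G v) with hg
  have hgm : ∀ v, Measurable (g v) := fun v =>
    ((A.measurable_coe (hG v)).comp hR).ennreal_toReal
  have hg0 : ∀ v x, 0 ≤ g v x := fun v x => measureReal_nonneg
  have hg1 : ∀ v x, g v x ≤ 1 := fun v x => measureReal_le_one
  have hgabs : ∀ v x, |g v x| ≤ 1 := fun v x => by
    rw [abs_of_nonneg (hg0 v x)]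
    exact hg1 v x
  have hgi : ∀ v, Integrable (g v) Q := fun v =>
    .of_bound (hgm v).aestronglyMeasurable 1 (.of_forall (hgabs v))
  have hbind : ∀ v, (((P v).map R).bind A).real (G v) = ∫ x, g v x ∂P v := fun v => by
    rw [measureReal_def, Measure.bind_apply (hG v) A.aemeasurable,
      lintegral_map (A.measurable_coe (hG v)) hR]
    exact (integral_toReal ((A.measurable_coe (hG v)).comp hR).aemeasurable
      (.of_forall fun x => measure_lt_top _ _)).symm
  have hsum : ∀ x, ∑ v, g v x ≤ N := fun x => by
    have h1 : ∀ v, g v x = ∫ q, (G v).indicator (fun _ => (1 : ℝ)) q ∂A (R x) := fun v => by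
      rw [integral_indicator_const _ (hG v)]
      simp [hg]
    have h2 : ∀ v, Integrable ((G v).indicator fun _ => (1 : ℝ)) (A (R x)) := fun v =>
      (integrable_const (1 : ℝ)).indicator (hG v)
    simp_rw [h1]
    rw [← integral_finsetSum _ fun v _ => h2 v]
    calc ∫ q, ∑ v, (G v).indicator (fun _ => (1 : ℝ)) q ∂A (R x) ≤ ∫ _q, N ∂A (R x) :=
          integral_mono (integrable_finsetSum _ fun v _ => h2 v) (integrable_const N) hN
      _ = N := by simp
  have hκ : 0 < Real.exp κ := Real.exp_pos κ
  -- This `α` is optimal for success probability `2/3`: it yields the Cauchy–Schwarz bound `(2/3)² ≤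
  -- exp κ * ∫ g v ∂Q`, using `g² ≤ g`.
  have hone : ∀ v, 1 / 3 ≤ 3 / 4 * Real.exp κ * ∫ x, g v x ∂Q := fun v => by
    have h1 := (hPQ v).integral_le (hgm v) (hgabs v) (α := 2 / 3 * (Real.exp κ)⁻¹) (by positivity)
    have h2 := hA v
    rw [hbind v] at h2
    have h3 : ∫ x, g v x ^ 2 ∂Q ≤ ∫ x, g v x ∂Q :=
      integral_mono_of_nonneg (.of_forall fun x => sq_nonneg _) (hgi v) (.of_forall fun x => by
        simp only
        nlinarith [hg0 v x, hg1 v x])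
    have h4 : 2 / 3 * (Real.exp κ)⁻¹ / 2 * Real.exp κ = 1 / 3 := by
      field_simp
    have h5 : 1 / (2 * (2 / 3 * (Real.exp κ)⁻¹)) = 3 / 4 * Real.exp κ := by
      field_simp
      norm_num
    rw [h4, h5] at h1
    have h6 : 3 / 4 * Real.exp κ * ∫ x, g v x ^ 2 ∂Q ≤ 3 / 4 * Real.exp κ * ∫ x, g v x ∂Q := by
      gcongr
    linarith
  have htot := Finset.sum_le_sum fun v (_ : v ∈ Finset.univ) => hone v
  rw [← Finset.mul_sum, ← integral_finsetSum _ fun v _ => hgi v, Finset.sum_const,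
    Finset.card_univ, nsmul_eq_mul] at htot
  have hint : ∫ x, ∑ v, g v x ∂Q ≤ N := by
    calc ∫ x, ∑ v, g v x ∂Q ≤ ∫ _x, N ∂Q :=
          integral_mono (integrable_finsetSum _ fun v _ => hgi v) (integrable_const N) hsum
      _ = N := by simp
  have : 3 / 4 * Real.exp κ * ∫ x, ∑ v, g v x ∂Q ≤ 3 / 4 * Real.exp κ * N := by gcongr
  linarith

/-! ### The hard family and the sample bound -/

/-- Rectified Gaussians with a diagonal weight matrix have independent coordinates. -/
theorem rectifiedGaussian_diagonal {d : ℕ} (s : Fin d → ℝ) :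
    (rectifiedGaussian (Matrix.diagonal fun i => (s i)⁻¹) 0 : Measure (Fin d → ℝ)) =
      (scaledGaussianPi s).map fun y i => max (y i) 0 := by
  have hm : Measurable fun (y : Fin d → ℝ) i => max (y i) 0 :=
    measurable_pi_lambda _ fun i => (measurable_pi_apply i).max measurable_const
  have hs : Measurable fun (z : Fin d → ℝ) i => (s i)⁻¹ * z i :=
    measurable_pi_lambda _ fun i => (measurable_pi_apply i).const_mul _
  have hpi : scaledGaussianPi s =
      (Measure.pi fun _ : Fin d => gaussianReal 0 1).map fun z i => (s i)⁻¹ * z i := by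
    unfold scaledGaussianPi scaledGaussian
    have : ∀ i, SigmaFinite ((gaussianReal 0 1).map fun z => (s i)⁻¹ * z) := fun i =>
      inferInstanceAs (SigmaFinite (scaledGaussian (s i)))
    exact (Measure.pi_map_pi fun i => (measurable_const_mul _).aemeasurable).symm
  rw [hpi, Measure.map_map hm hs]
  change Measure.map (reluLayer _ 0) _ = _
  congr 1
  funext z i
  simp [reluLayer, Matrix.mulVec_diagonal]

theorem rectifiedGaussian_diagonal_mem_fullRankClass {d : ℕ} {s : Fin d → ℝ}
    (hs : ∀ i, s i ≠ 0) :
    rectifiedGaussian (Matrix.diagonal fun i => (s i)⁻¹) 0 ∈ fullRankClass d := by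
  refine ⟨_, ?_, rfl⟩
  rw [Matrix.rank_diagonal]
  simp [hs]

theorem theorem3 :
    ∃ c ε₀ : ℝ, 0 < c ∧ 0 < ε₀ ∧
      ∀ (d n : ℕ) (ε : ℝ), 0 < ε → ε ≤ ε₀ →
        ∀ A : Kernel (Fin n → (Fin d → ℝ)) (ProbabilityMeasure (Fin d → ℝ)), IsMarkovKernel A →
          LearnsInTV A (fullRankClass d) ε →
            c * (d : ℝ) / ε ^ 2 ≤ (n : ℝ) := by
  -- As `6656 = 2 * 3328`, fewer than `c d / ε²` samples keep the exponent below `d / 2`. The bound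
  -- on `ε` ensures `16 δ ≤ 1/5` and `3328 d δ² ≤ 1`.
  refine ⟨1 / (6656 * 1300000 ^ 2), 1 / 10 ^ 9, by norm_num, by norm_num, ?_⟩
  intro d n ε hε hε₀ A hA hlearn
  rcases Nat.eq_zero_or_pos d with rfl | hd
  · simp
  have hd' : (1 : ℝ) ≤ d := by exact_mod_cast hd
  have hsd : 1 ≤ √(d : ℝ) := Real.one_le_sqrt.2 hd'
  have hsd2 : √(d : ℝ) ^ 2 = d := Real.sq_sqrt (by linarith)
  -- Any factor above `1280000` gives the strict separation by more than `2ε`.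
  set δ : ℝ := 1300000 * ε / √d with hδ
  have hδ0 : 0 < δ := by positivity
  have hsδ : √(d : ℝ) * δ = 1300000 * ε := by
    rw [hδ]
    field_simp
  have hdδ : d * δ ^ 2 = (1300000 * ε) ^ 2 := by
    rw [← hsδ, mul_pow, hsd2]
  have hδle : δ ≤ 1300000 * ε := div_le_self (by positivity) hsd
  have hδ5 : 16 * δ ≤ 1 / 5 := by
    norm_num at hε₀
    linarith
  have hdδ1 : 3328 * d * δ ^ 2 ≤ 1 := by
    rw [mul_assoc, hdδ]
    norm_num at hε₀
    nlinarith
  set s : (Fin d → Fin 16) → Fin d → ℝ := fun v i => 1 + δ * ((v i : ℕ) : ℝ) with hs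
  have hsI : ∀ v i, s v i ∈ Set.Icc 1 (1 + 16 * δ) := fun v i => by
    have h1 : (((v i : ℕ) : ℝ)) ≤ 16 := by exact_mod_cast (v i).2.le
    have h2 : (0 : ℝ) ≤ ((v i : ℕ) : ℝ) := Nat.cast_nonneg _
    constructor <;> simp only [hs] <;> nlinarith
  have hsep : ∀ v w : Fin d → Fin 16, ∀ i, v i ≠ w i → δ ≤ |s v i - s w i| := by
    intro v w i hvw
    have h1 : s v i - s w i = δ * ((((v i : ℕ) : ℤ) - ((w i : ℕ) : ℤ) : ℤ) : ℝ) := by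
      simp only [hs]
      push_cast
      ring
    have h2 : ((v i : ℕ) : ℤ) - ((w i : ℕ) : ℤ) ≠ 0 := fun h =>
      hvw (Fin.ext (by exact_mod_cast sub_eq_zero.1 h))
    rw [h1, abs_mul, abs_of_pos hδ0]
    have h3 : (1 : ℝ) ≤ |((((v i : ℕ) : ℤ) - ((w i : ℕ) : ℤ) : ℤ) : ℝ)| := by
      exact_mod_cast Int.one_le_abs h2
    nlinarith
  set p : (Fin d → Fin 16) → ProbabilityMeasure (Fin d → ℝ) := fun v =>
    rectifiedGaussian (Matrix.diagonal fun i => (s v i)⁻¹) 0 with hp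
  have hpmem : ∀ v, p v ∈ fullRankClass d := fun v =>
    rectifiedGaussian_diagonal_mem_fullRankClass fun i => by linarith [(hsI v i).1]
  have hsets : ∀ v w : Fin d → Fin 16, ∃ B : Set (Fin d → ℝ), MeasurableSet B ∧
      (d ≤ 4 * (Finset.univ.filter fun i => v i ≠ w i).card →
        2 * ε < (p v : Measure (Fin d → ℝ)).real B - (p w : Measure (Fin d → ℝ)).real B) := by
    intro v w
    by_cases h : d ≤ 4 * (Finset.univ.filter fun i => v i ≠ w i).card
    · obtain ⟨B, hB, hB'⟩ := exists_measureReal_sub_gt (ε := ε) hd hδ0 hδ5 hdδ1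
        (by rw [hsδ]; linarith) (hsI v) (hsI w) (h.trans (Nat.mul_le_mul_left 4
          (Finset.card_le_card (Finset.monotone_filter_right _ fun i _ => hsep v w i))))
      refine ⟨B, hB, fun _ => ?_⟩
      simp only [hp]
      rwa [rectifiedGaussian_diagonal, rectifiedGaussian_diagonal]
    · exact ⟨∅, MeasurableSet.empty, fun h' => absurd h' h⟩
  choose B hBm hB using hsets
  -- The total variation ball is enlarged to a set cut out by finitely many tests, which makes
  -- measurability immediate. The tests `B v w` are all that is needed to separate distant words.
  set G : (Fin d → Fin 16) → Set (ProbabilityMeasure (Fin d → ℝ)) := fun v =>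
    {q | ∀ a b, |(p v : Measure (Fin d → ℝ)).real (B a b) -
      (q : Measure (Fin d → ℝ)).real (B a b)| ≤ ε} with hG
  have hGm : ∀ v, MeasurableSet (G v) := by
    intro v
    have h1 : ∀ a b, Measurable fun q : ProbabilityMeasure (Fin d → ℝ) =>
        (q : Measure (Fin d → ℝ)).real (B a b) := fun a b =>
      ((Measure.measurable_coe (hBm a b)).comp measurable_subtype_coe).ennreal_toReal
    simp only [hG, Set.ofPred_forall]
    refine MeasurableSet.iInter fun a => MeasurableSet.iInter fun b => ?_
    exact measurableSet_le ((h1 a b).const_sub _).abs measurable_const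
  have hGsub : ∀ v, {q | tvDist (p v) q ≤ ε} ⊆ G v := fun v q hq a b =>
    (measureReal_sub_le_tvDist (p v) q (hBm a b)).trans hq
  have hclose : ∀ v w q, q ∈ G v → q ∈ G w →
      4 * (Finset.univ.filter fun i => v i ≠ w i).card < d := by
    intro v w q hv hw
    by_contra! h
    have h1 := hB v w h
    have h2 := abs_le.1 (hv v w)
    have h3 := abs_le.1 (hw v w)
    linarith
  have hN : ∀ q, ∑ v, (G v).indicator (fun _ => (1 : ℝ)) q ≤ 4 ^ d := by
    classical
    intro q
    have h1 : ∑ v, (G v).indicator (fun _ => (1 : ℝ)) q =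
        (Finset.univ.filter fun v => q ∈ G v).card := by
      simp only [Set.indicator_apply]
      rw [Finset.sum_boole]
    rw [h1]
    rcases (Finset.univ.filter fun v => q ∈ G v).eq_empty_or_nonempty with h | ⟨w, hw⟩
    · rw [h]
      simp
    · refine le_trans ?_ (card_filter_hamming_lt_le w)
      refine Nat.cast_le.2 (Finset.card_le_card (Finset.monotone_filter_right _ fun v _ hv => ?_))
      exact hclose v w q hv (Finset.mem_filter.1 hw).2
  have hRd : Measurable fun (y : Fin d → ℝ) i => max (y i) 0 :=
    measurable_pi_lambda _ fun i => (measurable_pi_apply i).max measurable_const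
  have hRn : Measurable fun (x : Fin n → Fin d → ℝ) j i => max (x j i) 0 :=
    measurable_pi_lambda _ fun j => hRd.comp (measurable_pi_apply j)
  have hsample : ∀ v, (Measure.pi fun _ : Fin n => (p v : Measure (Fin d → ℝ))) =
      (Measure.pi fun _ : Fin n => scaledGaussianPi (s v)).map fun x j i => max (x j i) 0 := by
    intro v
    have hprob : IsProbabilityMeasure ((scaledGaussianPi (s v)).map fun y i => max (y i) 0) :=
      Measure.isProbabilityMeasure_map hRd.aemeasurable
    have h1 : (p v : Measure (Fin d → ℝ)) = (scaledGaussianPi (s v)).map fun y i => max (y i) 0 :=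
      rectifiedGaussian_diagonal (s v)
    rw [h1]
    exact (Measure.pi_map_pi fun j => hRd.aemeasurable).symm
  have hdens : ∀ v, HasSquareDensity (Measure.pi fun _ : Fin n => scaledGaussianPi (s v))
      (Measure.pi fun _ : Fin n => scaledGaussianPi (s fun _ => 0))
      (n * (3328 * d * δ ^ 2)) := fun v => by
    have := HasSquareDensity.pi fun _ : Fin n =>
      hasSquareDensity_scaledGaussianPi hδ5 (hsI v) (hsI fun _ => 0)
    rwa [Fintype.card_fin] at this
  have hfinal := card_le_of_forall_bind_ge hdens hRn A hGm hN fun v => by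
    rw [← hsample v]
    have hprob : IsProbabilityMeasure
        ((Measure.pi fun _ : Fin n => (p v : Measure (Fin d → ℝ))).bind A) := inferInstance
    exact (hlearn (p v) (hpmem v)).trans (measureReal_mono (hGsub v))
  rw [Fintype.card_fun, Fintype.card_fin, Fintype.card_fin, mul_assoc 3328, hdδ] at hfinal
  push_cast at hfinal
  rw [div_le_iff₀ (by positivity)]
  by_contra! hlt
  have hκ : n * (3328 * (1300000 * ε) ^ 2) ≤ d * (1 / 2) := by
    linarith
  -- The bound `16/9 = 4 * (4/9)` is chosen so that `(16/9) ^ d * 4 ^ d = 16 ^ d * (4/9) ^ d`, which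
  -- is at most `4/9 * 16 ^ d` because `d ≥ 1`.
  have hhalf : Real.exp (1 / 2) < 16 / 9 := by
    have h1 : Real.exp (1 / 2) ^ 2 = Real.exp 1 := by
      rw [← Real.exp_nat_mul]
      norm_num
    refine lt_of_pow_lt_pow_left₀ 2 (by norm_num) ?_
    rw [h1]
    exact Real.exp_one_lt_d9.trans (by norm_num)
  have hexp : Real.exp (n * (3328 * (1300000 * ε) ^ 2)) ≤ Real.exp (1 / 2) ^ d := by
    rw [← Real.exp_nat_mul]
    exact Real.exp_le_exp.2 hκ
  have hpow : Real.exp (1 / 2) ^ d < (16 / 9) ^ d :=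
    pow_lt_pow_left₀ hhalf (Real.exp_nonneg _) hd.ne'
  have h49 : (4 / 9 : ℝ) ^ d ≤ 4 / 9 := pow_le_of_le_one (by norm_num) (by norm_num) hd.ne'
  have h16 : (16 : ℝ) ^ d * (4 / 9) ^ d = (16 / 9) ^ d * 4 ^ d := by
    rw [← mul_pow, ← mul_pow]
    norm_num
  have h4d : (0 : ℝ) < 4 ^ d := by positivity
  have h16d : (0 : ℝ) < 16 ^ d := by positivity
  have hc1 : Real.exp (n * (3328 * (1300000 * ε) ^ 2)) * 4 ^ d < (16 / 9) ^ d * 4 ^ d :=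
    mul_lt_mul_of_pos_right (hexp.trans_lt hpow) h4d
  have hc2 : (16 : ℝ) ^ d * (4 / 9) ^ d ≤ 16 ^ d * (4 / 9) := by gcongr
  linarith
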